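/- A source sends time-stamped updates $j=1,2,\dots$ to $n$ nodes, of which nodes $1,\dots,k$ ($1\le k\le n$) form the priority group. The delay $X_{ij}$ of update $j$ to node $i$ is shifted exponential $(\lambda,c)$ with $\lambda>0$, $c\ge 0$, that is $P(X_{ij}\le x)=1-e^{-\lambda(x-c)}$ for $x\ge c$ and $0$ for $x<c$, and all the $X_{ij}$ are independent. Update $1$ is generated at time $T_0=0$. Update $j$, generated at time $T_{j-1}$, reaches node $i$ at time $T_{j-1}+X_{ij}$, unless the update has been terminated before; it is terminated at time $T_j=T_{j-1}+Y_j$, $Y_j=\max(X_{1j},\dots,X_{kj})$, when all priority nodes have received it, and update $j+1$ is then generated immediately. Let $u_i(t)$ be the generation time of the most recent update that node $i$ has received by time $t$ (with an arbitrary initial value $u_i\le 0$ until the first reception), and let $\Delta_i(t)=t-u_i(t)$ be the age at node $i$. Then, given $\lambda$, $c$ and $k$, there is a number $\Delta_P$, independent of $n$, such that for every priority node $i\le k$, almost surely, $$\lim_{\tau\to\infty}\frac1\tau\int_0^\tau \Delta_i(t)\,dt=\Delta_P ,$$ and $$\Delta_P\;\ge\;\frac{3c}{2}+\frac1\lambda+\frac{\log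 k+\gamma}{2\lambda},$$ where $\gamma$ is the Euler–Mascheroni constant. -/

import Mathlib

open MeasureTheory ProbabilityTheory Filter Topology

noncomputable section

namespace MulticastAge

/-- The shifted exponential law `(lam, c)`: the law of `c + Z`, `Z` exponential of rate `lam`.
Its CDF is `1 - exp (-lam * (x - c))` for `x ≥ c`, and `0` for `x < c`. -/
def shiftedExp (lam c : ℝ) : Measure ℝ := (expMeasure lam).map (fun z => c + z)

/-! The multicast system, path by path. There are `n` nodes, of which nodes `i` with `i < k`
form the priority group; `x i j` is the link delay of update `j` to node `i`. Updates are numbered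
`0, 1, 2, …`. -/

/-- Service interval of update `j`: the largest delay of update `j` over the priority nodes. -/
def serviceInterval {n : ℕ} (k : ℕ) (x : Fin n → ℕ → ℝ) (j : ℕ) : ℝ :=
  ⨆ i : {i : Fin n // (i : ℕ) < k}, x i.1 j

/-- Time at which update `j` is generated (its timestamp). Update `0` is generated at time `0`, and
each later update as soon as the previous one has reached all priority nodes. -/
def timestamp {n : ℕ} (k : ℕ) (x : Fin n → ℕ → ℝ) (j : ℕ) : ℝ :=
  ∑ m ∈ Finset.range j, serviceInterval k x m

/-- Node `i` has received update `j` by time `t`: the delivery was not cut off by the termination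
of the update (which never happens to a priority node), and it is over by time `t`. -/
def Received {n : ℕ} (k : ℕ) (x : Fin n → ℕ → ℝ) (i : Fin n) (j : ℕ) (t : ℝ) : Prop :=
  x i j ≤ serviceInterval k x j ∧ timestamp k x j + x i j ≤ t

/-- Timestamp of the most recent update that node `i` has at time `t`; `u₀` is the timestamp of
what node `i` holds at the beginning. Updates arrive at a node in the order of their timestamps, so
the most recently received one is the one with the largest timestamp. -/
def latestTimestamp {n : ℕ} (k : ℕ) (x : Fin n → ℕ → ℝ) (u₀ : ℝ) (i : Fin n) (t : ℝ) : ℝ :=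
  sSup (insert u₀ {s : ℝ | ∃ j : ℕ, Received k x i j t ∧ timestamp k x j = s})

/-- The age process of node `i`. -/
def age {n : ℕ} (k : ℕ) (x : Fin n → ℕ → ℝ) (u₀ : ℝ) (i : Fin n) (t : ℝ) : ℝ :=
  t - latestTimestamp k x u₀ i t

/-- `f` is integrable on bounded intervals `[0, τ]`, and its time average exists and equals `a`. -/
def HasTimeAverage (f : ℝ → ℝ) (a : ℝ) : Prop :=
  (∀ τ : ℝ, 0 ≤ τ → IntervalIntegrable f volume 0 τ) ∧
    Tendsto (fun τ : ℝ => (1 / τ) * ∫ t in (0 : ℝ)..τ, f t) atTop (𝓝 a)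

end MulticastAge

end

/-! Let `Y j` be the service interval of update `j` and `T j` its timestamp. A priority node `i`
receives every update, so its age is a sawtooth of slope one: on `[T j, T (j + 1)]` it is measured
from `T (j - 1)` until the arrival at `T j + X i j`, and from `T j` afterwards. The area over this
interval is `Y j ^ 2 / 2 + Y (j - 1) * X i j` for `j ≥ 1` (`age_integral_service`). The factors `Y
(j - 1)` and `X i j` belong to different updates, hence are independent. By the strong law the areas
have average `E[Y²] / 2 + (c + 1 / lam) * E[Y]` and the lengths have average `E[Y]`; the quotient is
the time average (`hasTimeAverage_of_tendsto`), that is, `E[Y²] / (2 E[Y]) + c + 1 / lam`. The law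
of `Y` involves only `lam`, `c`, `k`, so `n` plays no role. The bound follows from `E[Y²] ≥ E[Y]²`,
from `E[Y] = c + H_k / lam` (`integral_id_maxLaw`) and from `H_k ≥ log k + γ`. -/

namespace MulticastAge

/-! ### Sample paths: the sawtooth age of a priority node -/

section Path

variable {n : ℕ} {k : ℕ} {x : Fin n → ℕ → ℝ} {i : Fin n} {u₀ : ℝ}

lemma le_serviceInterval (hi : (i : ℕ) < k) (j : ℕ) : x i j ≤ serviceInterval k x j :=
  le_ciSup (f := fun i : {i : Fin n // (i : ℕ) < k} => x i.1 j) (Set.finite_range _).bddAbove ⟨i, hi⟩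

lemma timestamp_zero : timestamp k x 0 = 0 := by simp [timestamp]

lemma timestamp_succ (j : ℕ) :
    timestamp k x (j + 1) = timestamp k x j + serviceInterval k x j := by
  simp [timestamp, Finset.sum_range_succ]

lemma timestamp_strictMono (hi : (i : ℕ) < k) (hx : ∀ j, 0 < x i j) :
    StrictMono (timestamp k x) :=
  strictMono_nat_of_lt_succ fun j => by
    rw [timestamp_succ]
    linarith [hx j, le_serviceInterval (x := x) hi j]

lemma timestamp_nonneg (hi : (i : ℕ) < k) (hx : ∀ j, 0 < x i j) (j : ℕ) :
    0 ≤ timestamp k x j := by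
  rw [← timestamp_zero (k := k) (x := x)]
  exact (timestamp_strictMono hi hx).monotone (Nat.zero_le j)

lemma received_iff (hi : (i : ℕ) < k) (j : ℕ) (t : ℝ) :
    Received k x i j t ↔ timestamp k x j + x i j ≤ t :=
  ⟨fun h => h.2, fun h => ⟨le_serviceInterval hi j, h⟩⟩

lemma arrival_strictMono (hi : (i : ℕ) < k) (hx : ∀ j, 0 < x i j) :
    StrictMono (fun j => timestamp k x j + x i j) :=
  strictMono_nat_of_lt_succ fun j => by
    have := le_serviceInterval (x := x) hi j
    have := hx (j + 1)
    simp only [timestamp_succ]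
    linarith

lemma latestTimestamp_of_lt (hi : (i : ℕ) < k) (hx : ∀ j, 0 < x i j) {t : ℝ}
    (ht : t < x i 0) : latestTimestamp k x u₀ i t = u₀ := by
  have : {s : ℝ | ∃ j : ℕ, Received k x i j t ∧ timestamp k x j = s} = ∅ := by
    refine Set.eq_empty_of_forall_notMem ?_
    rintro s ⟨j, hj, -⟩
    rw [received_iff hi] at hj
    have := (arrival_strictMono hi hx).monotone (Nat.zero_le j)
    simp only [timestamp_zero] at this
    linarith
  simp [latestTimestamp, this]

lemma latestTimestamp_of_mem (hi : (i : ℕ) < k) (hx : ∀ j, 0 < x i j) (hu : u₀ ≤ 0) {t : ℝ}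
    {j : ℕ} (h1 : timestamp k x j + x i j ≤ t)
    (h2 : t < timestamp k x (j + 1) + x i (j + 1)) :
    latestTimestamp k x u₀ i t = timestamp k x j := by
  refine IsGreatest.csSup_eq ⟨Or.inr ⟨j, (received_iff hi j t).2 h1, rfl⟩, ?_⟩
  rintro s (rfl | ⟨m, hm, rfl⟩)
  · exact hu.trans (timestamp_nonneg hi hx j)
  · rw [received_iff hi] at hm
    have : m < j + 1 := (arrival_strictMono hi hx).lt_iff_lt.1 (hm.trans_lt h2)
    exact (timestamp_strictMono hi hx).monotone (by omega)

lemma age_nonneg (hi : (i : ℕ) < k) (hx : ∀ j, 0 < x i j) (hu : u₀ ≤ 0) {t : ℝ} (ht : 0 ≤ t) :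
    0 ≤ age k x u₀ i t := by
  refine sub_nonneg.2 (csSup_le (Set.insert_nonempty _ _) ?_)
  rintro s (rfl | ⟨m, hm, rfl⟩)
  · exact hu.trans ht
  · rw [received_iff hi] at hm
    linarith [hx m]

/-- Timestamp of what a priority node holds while it waits for update `j`. -/
noncomputable def heldTimestamp (k : ℕ) (x : Fin n → ℕ → ℝ) (u₀ : ℝ) : ℕ → ℝ
  | 0 => u₀
  | j + 1 => timestamp k x j

lemma age_of_waiting (hi : (i : ℕ) < k) (hx : ∀ j, 0 < x i j) (hu : u₀ ≤ 0) {t : ℝ}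
    {j : ℕ} (h1 : timestamp k x j ≤ t) (h2 : t < timestamp k x j + x i j) :
    age k x u₀ i t = t - heldTimestamp k x u₀ j := by
  cases j with
  | zero =>
    rw [timestamp_zero, zero_add] at h2
    rw [age, latestTimestamp_of_lt hi hx h2, heldTimestamp]
  | succ j =>
    rw [age, heldTimestamp, latestTimestamp_of_mem hi hx hu _ h2]
    have := le_serviceInterval (x := x) hi j
    rw [timestamp_succ] at h1
    linarith

lemma age_of_received (hi : (i : ℕ) < k) (hx : ∀ j, 0 < x i j) (hu : u₀ ≤ 0) {t : ℝ}
    {j : ℕ} (h1 : timestamp k x j + x i j ≤ t) (h2 : t ≤ timestamp k x (j + 1)) :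
    age k x u₀ i t = t - timestamp k x j := by
  rw [age, latestTimestamp_of_mem hi hx hu h1]
  linarith [hx (j + 1)]

/-- Integral over an interval of a function that is affine of slope one inside it. -/
lemma intervalIntegrable_and_integral_of_eq_sub {f : ℝ → ℝ} {a b s : ℝ} (hab : a ≤ b)
    (hf : ∀ t ∈ Set.Ioo a b, f t = t - s) :
    IntervalIntegrable f volume a b ∧
      ∫ t in a..b, f t = (b ^ 2 - a ^ 2) / 2 - s * (b - a) := by
  -- The endpoints, where the age may jump, form a null set.
  have hae : ∀ᵐ t ∂(volume.restrict (Set.uIoc a b)), t - s = f t := by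
    rw [Set.uIoc_of_le hab, ← restrict_Ioo_eq_restrict_Ioc]
    exact (ae_restrict_iff' measurableSet_Ioo).2 (ae_of_all _ fun t ht => (hf t ht).symm)
  refine ⟨IntervalIntegrable.congr_ae (f := fun t => t - s)
    (Continuous.intervalIntegrable (by fun_prop) _ _) hae, ?_⟩
  rw [← intervalIntegral.integral_congr_ae_restrict hae, intervalIntegral.integral_sub
    (Continuous.intervalIntegrable (by fun_prop) _ _)
    (Continuous.intervalIntegrable (by fun_prop) _ _)]
  simp [integral_id]
  ring

/-- The interval is cut at the arrival of update `j`. Relative to a sawtooth restarting at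
`timestamp k x j`, the age before the arrival is larger by a constant, which gives a triangle plus a
rectangle of width `x i j`. -/
lemma age_integral_service (hi : (i : ℕ) < k) (hx : ∀ j, 0 < x i j) (hu : u₀ ≤ 0) (j : ℕ) :
    IntervalIntegrable (age k x u₀ i) volume (timestamp k x j) (timestamp k x (j + 1)) ∧
      ∫ t in (timestamp k x j)..(timestamp k x (j + 1)), age k x u₀ i t =
        serviceInterval k x j ^ 2 / 2
          + (timestamp k x j - heldTimestamp k x u₀ j) * x i j := by
  have hxy := le_serviceInterval (x := x) hi j
  have hs := timestamp_succ (k := k) (x := x) j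
  obtain ⟨h1, e1⟩ := intervalIntegrable_and_integral_of_eq_sub (f := age k x u₀ i)
    (a := timestamp k x j) (b := timestamp k x j + x i j) (by linarith [hx j])
    (fun t ht => age_of_waiting hi hx hu ht.1.le ht.2)
  obtain ⟨h2, e2⟩ := intervalIntegrable_and_integral_of_eq_sub (f := age k x u₀ i)
    (a := timestamp k x j + x i j) (b := timestamp k x (j + 1)) (by linarith)
    (fun t ht => age_of_received hi hx hu ht.1.le ht.2.le)
  refine ⟨h1.trans h2, ?_⟩
  rw [← intervalIntegral.integral_add_adjacent_intervals h1 h2, e1, e2, hs]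
  ring

lemma age_integral_timestamp (hi : (i : ℕ) < k) (hx : ∀ j, 0 < x i j) (hu : u₀ ≤ 0) (m : ℕ) :
    IntervalIntegrable (age k x u₀ i) volume 0 (timestamp k x m) ∧
      ∫ t in (0 : ℝ)..(timestamp k x m), age k x u₀ i t =
        ∑ j ∈ Finset.range m, (serviceInterval k x j ^ 2 / 2
          + (timestamp k x j - heldTimestamp k x u₀ j) * x i j) := by
  have h := fun j => age_integral_service (u₀ := u₀) hi hx hu j
  constructor
  · have := IntervalIntegrable.trans_iterate (n := m) (fun j _ => (h j).1)
    rwa [timestamp_zero] at this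
  · have := intervalIntegral.sum_integral_adjacent_intervals (n := m) (fun j _ => (h j).1)
    rw [timestamp_zero] at this
    rw [← this]
    exact Finset.sum_congr rfl fun j _ => (h j).2

end Path

/-! ### Passage from averages over updates to time averages -/

/-- A nonnegative function whose integrals up to the times `T m` grow like `A * m`, where `T m`
itself grows like `B * m`, has time average `A / B`. -/
lemma hasTimeAverage_of_tendsto {f : ℝ → ℝ} {T : ℕ → ℝ} {A B : ℝ} (hB : 0 < B)
    (hf : ∀ t, 0 ≤ t → 0 ≤ f t) (hT0 : T 0 = 0) (hT : StrictMono T)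
    (hint : ∀ m, IntervalIntegrable f volume 0 (T m))
    (hTB : Tendsto (fun m : ℕ => T m / m) atTop (𝓝 B))
    (hfA : Tendsto (fun m : ℕ => (∫ t in (0 : ℝ)..(T m), f t) / m) atTop (𝓝 A)) :
    HasTimeAverage f (A / B) := by
  have hTtop : Tendsto T atTop atTop := by
    have h := hTB.pos_mul_atTop hB (tendsto_natCast_atTop_atTop (R := ℝ))
    refine h.congr' ?_
    filter_upwards [eventually_gt_atTop 0] with m hm
    field_simp
  have hTnn : ∀ m, 0 ≤ T m := fun m => hT0 ▸ hT.monotone (Nat.zero_le m)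
  have hex : ∀ τ : ℝ, ∃ m, τ < T (m + 1) := fun τ =>
    ((hTtop.comp (tendsto_add_atTop_nat 1)).eventually_gt_atTop τ).exists
  have hII : ∀ τ, 0 ≤ τ → IntervalIntegrable f volume 0 τ := fun τ hτ => by
    obtain ⟨m, hm⟩ := hex τ
    refine (hint (m + 1)).mono_set ?_
    rw [Set.uIcc_of_le hτ, Set.uIcc_of_le (hTnn _)]
    exact Set.Icc_subset_Icc_right hm.le
  refine ⟨hII, ?_⟩
  have hmono : ∀ a b, 0 ≤ a → a ≤ b → ∫ t in (0 : ℝ)..a, f t ≤ ∫ t in (0 : ℝ)..b, f t := by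
    intro a b ha hab
    rw [← sub_nonneg, intervalIntegral.integral_interval_sub_left (hII b (ha.trans hab)) (hII a ha)]
    exact intervalIntegral.integral_nonneg hab fun t ht => hf t (ha.trans ht.1)
  have hnn : ∀ a, 0 ≤ a → 0 ≤ ∫ t in (0 : ℝ)..a, f t := fun a ha =>
    intervalIntegral.integral_nonneg ha fun t ht => hf t ht.1
  classical
  -- `N τ` is the index of the service interval containing `τ`: `T (N τ) ≤ τ < T (N τ + 1)`.
  let N : ℝ → ℕ := fun τ => Nat.find (hex τ)
  have hN1 : ∀ τ, τ < T (N τ + 1) := fun τ => Nat.find_spec (hex τ)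
  have hN2 : ∀ τ, 0 ≤ τ → T (N τ) ≤ τ := fun τ hτ => by
    rcases Nat.eq_zero_or_pos (N τ) with h | h
    · rw [h, hT0]; exact hτ
    · have := Nat.find_min (hex τ) (Nat.sub_lt h one_pos)
      rw [show Nat.find (hex τ) = N τ from rfl,
        Nat.sub_add_cancel (Nat.one_le_iff_ne_zero.2 h.ne')] at this
      exact not_lt.1 this
  have hNtop : Tendsto N atTop atTop := by
    refine tendsto_atTop.2 fun m => ?_
    filter_upwards [eventually_ge_atTop (T m)] with τ hτ
    exact Nat.lt_succ_iff.1 (hT.lt_iff_lt.1 (hτ.trans_lt (hN1 τ)))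
  have hshift : Tendsto (fun m : ℕ => ((m + 1 : ℕ) : ℝ) / m) atTop (𝓝 1) := by
    have : Tendsto (fun m : ℕ => 1 + 1 / (m : ℝ)) atTop (𝓝 (1 + 0)) :=
      tendsto_const_nhds.add tendsto_one_div_atTop_nhds_zero_nat
    rw [add_zero] at this
    refine this.congr' ?_
    filter_upwards [eventually_gt_atTop 0] with m hm
    push_cast
    field_simp
  have hTB' := (hTB.comp (tendsto_add_atTop_nat 1)).mul hshift
  have hfA' := (hfA.comp (tendsto_add_atTop_nat 1)).mul hshift
  rw [mul_one] at hTB' hfA'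
  have hlow := (hfA.div hTB' hB.ne').comp hNtop
  have hupp := (hfA'.div hTB hB.ne').comp hNtop
  -- As `f ≥ 0`, the average up to `τ` lies between the integral to `T (N τ)` over `T (N τ + 1)` and
  -- the integral to `T (N τ + 1)` over `T (N τ)`; both tend to `A / B`.
  refine tendsto_of_tendsto_of_tendsto_of_le_of_le' hlow hupp ?_ ?_
  · filter_upwards [eventually_gt_atTop 0, hNtop.eventually_gt_atTop 0] with τ hτ hN
    have hN' : (0 : ℝ) < N τ := by exact_mod_cast hN
    have hT1 : 0 < T (N τ + 1) := hτ.trans (hN1 τ)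
    have e : ((fun m : ℕ => (∫ t in (0 : ℝ)..(T m), f t) / m) / fun m : ℕ =>
        ((fun m : ℕ => T m / m) ∘ fun a => a + 1) m * (((m + 1 : ℕ) : ℝ) / m)) (N τ)
        = (∫ t in (0 : ℝ)..(T (N τ)), f t) / T (N τ + 1) := by
      simp only [Pi.div_apply, Function.comp]
      field_simp
    simp only [Function.comp_apply]
    refine e.le.trans ?_
    rw [one_div, inv_mul_eq_div]
    exact div_le_div₀ (hnn _ hτ.le) (hmono _ _ (hTnn _) (hN2 τ hτ.le)) hτ (hN1 τ).le
  · filter_upwards [eventually_gt_atTop 0, hNtop.eventually_gt_atTop 0] with τ hτ hN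
    have hN' : (0 : ℝ) < N τ := by exact_mod_cast hN
    have hT1 : 0 < T (N τ) := hT0 ▸ hT hN
    have e : ((fun m : ℕ => ((fun m : ℕ => (∫ t in (0 : ℝ)..(T m), f t) / m) ∘ fun a => a + 1) m
        * (((m + 1 : ℕ) : ℝ) / m)) / fun m : ℕ => T m / m) (N τ)
        = (∫ t in (0 : ℝ)..(T (N τ + 1)), f t) / T (N τ) := by
      simp only [Pi.div_apply, Function.comp]
      field_simp
    simp only [Function.comp_apply]
    refine le_trans ?_ e.ge
    rw [one_div, inv_mul_eq_div]
    exact div_le_div₀ (hnn _ (hTnn _)) (hmono _ _ hτ.le (hN1 τ).le) hT1 (hN2 τ hτ.le)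

/-- Cesàro averages of a sequence whose even and odd subsequences have the same average. -/
lemma tendsto_average_of_even_of_odd {w : ℕ → ℝ} {a : ℝ}
    (he : Tendsto (fun m : ℕ => (∑ j ∈ Finset.range m, w (2 * j)) / m) atTop (𝓝 a))
    (ho : Tendsto (fun m : ℕ => (∑ j ∈ Finset.range m, w (2 * j + 1)) / m) atTop (𝓝 a)) :
    Tendsto (fun m : ℕ => (∑ j ∈ Finset.range m, w j) / m) atTop (𝓝 a) := by
  have hsum : ∀ m : ℕ, ∑ j ∈ Finset.range m, w j =
      ∑ j ∈ Finset.range ((m + 1) / 2), w (2 * j) + ∑ j ∈ Finset.range (m / 2), w (2 * j + 1) := by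
    intro m
    induction m with
    | zero => simp
    | succ m ih =>
      rw [Finset.sum_range_succ, ih]
      rcases Nat.even_or_odd' m with ⟨l, rfl | rfl⟩
      · rw [show (2 * l + 1 + 1) / 2 = l + 1 by omega, show (2 * l + 1) / 2 = l by omega,
          show 2 * l / 2 = l by omega, Finset.sum_range_succ]
        ring
      · rw [show (2 * l + 1 + 1 + 1) / 2 = l + 1 by omega, show (2 * l + 1 + 1) / 2 = l + 1 by omega,
          show (2 * l + 1) / 2 = l by omega, Finset.sum_range_succ (fun j => w (2 * j + 1))]
        ring
  have hdiv : ∀ b : ℕ, Tendsto (fun m : ℕ => (m + b) / 2) atTop atTop := fun b =>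
    tendsto_atTop.2 fun l => by
      filter_upwards [eventually_ge_atTop (2 * l)] with m hm
      omega
  -- Among the first `m` indices `(m + 1) / 2` are even (`b = 1`) and `m / 2` are odd (`b = 0`);
  -- rounding costs at most `1 / m` in the ratio.
  have hratio : ∀ b : ℕ, b ≤ 1 →
      Tendsto (fun m : ℕ => (((m + b) / 2 : ℕ) : ℝ) / m) atTop (𝓝 (1 / 2)) := by
    intro b hb
    have h0 := tendsto_one_div_atTop_nhds_zero_nat (𝕜 := ℝ)
    have hl : Tendsto (fun m : ℕ => 1 / 2 - 1 / (m : ℝ)) atTop (𝓝 (1 / 2)) := by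
      simpa using (tendsto_const_nhds (x := (1 / 2 : ℝ))).sub h0
    have hu : Tendsto (fun m : ℕ => 1 / 2 + 1 / (m : ℝ)) atTop (𝓝 (1 / 2)) := by
      simpa using (tendsto_const_nhds (x := (1 / 2 : ℝ))).add h0
    refine tendsto_of_tendsto_of_tendsto_of_le_of_le' hl hu ?_ ?_
    all_goals
      filter_upwards [eventually_gt_atTop 0] with m hm
      have hm' : (0 : ℝ) < m := by exact_mod_cast hm
    · have : (m : ℝ) ≤ 2 * ((m + b) / 2 : ℕ) + 2 := by exact_mod_cast (by omega)
      rw [le_div_iff₀ hm', sub_mul, div_mul_cancel₀ _ hm'.ne']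
      linarith
    · have : (2 * ((m + b) / 2 : ℕ) : ℝ) ≤ m + 2 := by exact_mod_cast (by omega)
      rw [div_le_iff₀ hm', add_mul, div_mul_cancel₀ _ hm'.ne']
      linarith
  have key := ((he.comp (hdiv 1)).mul (hratio 1 le_rfl)).add
    ((ho.comp (hdiv 0)).mul (hratio 0 zero_le_one))
  rw [show a * (1 / 2) + a * (1 / 2) = a by ring] at key
  refine key.congr' ?_
  -- For `m > 1` both counts are nonzero and cancel.
  filter_upwards [eventually_gt_atTop 1] with m hm
  have h1 : (((m + 1) / 2 : ℕ) : ℝ) ≠ 0 := by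
    have : 0 < (m + 1) / 2 := by omega
    positivity
  have h2 : (((m + 0) / 2 : ℕ) : ℝ) ≠ 0 := by
    have : 0 < (m + 0) / 2 := by omega
    positivity
  simp only [Function.comp_apply]
  rw [div_mul_div_cancel₀ h1, div_mul_div_cancel₀ h2, ← add_div, hsum m]
  rfl

lemma hasTimeAverage_age {n k : ℕ} {x : Fin n → ℕ → ℝ} {i : Fin n} {u₀ : ℝ} (hi : (i : ℕ) < k)
    (hx : ∀ j, 0 < x i j) (hu : u₀ ≤ 0) {M₁ M₂ W : ℝ} (hM₁ : 0 < M₁)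
    (h1 : Tendsto (fun m : ℕ => (∑ j ∈ Finset.range m, serviceInterval k x j) / m) atTop (𝓝 M₁))
    (h2 : Tendsto (fun m : ℕ => (∑ j ∈ Finset.range m, serviceInterval k x j ^ 2) / m) atTop
      (𝓝 M₂))
    (hW : Tendsto (fun m : ℕ => (∑ j ∈ Finset.range m, x i (j + 1) * serviceInterval k x j) / m)
      atTop (𝓝 W)) :
    HasTimeAverage (age k x u₀ i) ((M₂ / 2 + W) / M₁) := by
  refine hasTimeAverage_of_tendsto (T := timestamp k x) hM₁
    (fun t ht => age_nonneg hi hx hu ht) timestamp_zero (timestamp_strictMono hi hx)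
    (fun m => (age_integral_timestamp hi hx hu m).1) h1 ?_
  have hwait : Tendsto (fun m : ℕ => (∑ j ∈ Finset.range m,
      (timestamp k x j - heldTimestamp k x u₀ j) * x i j) / m) atTop (𝓝 W) := by
    -- The term `j = 0` is split off: it alone carries the arbitrary `u₀`, and it vanishes after
    -- division.
    rw [← tendsto_add_atTop_iff_nat 1]
    have hr : Tendsto (fun m : ℕ => (m : ℝ) / ((m + 1 : ℕ) : ℝ)) atTop (𝓝 1) := by
      simpa using tendsto_natCast_div_add_atTop (1 : ℝ)
    have h0 : Tendsto (fun m : ℕ => (-u₀ * x i 0) / ((m + 1 : ℕ) : ℝ)) atTop (𝓝 0) :=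
      (tendsto_const_div_atTop_nhds_zero_nat _).comp (tendsto_add_atTop_nat 1)
    have key := (hW.mul hr).add h0
    rw [mul_one, add_zero] at key
    refine key.congr' ?_
    filter_upwards [eventually_gt_atTop 0] with m hm
    have hm' : (m : ℝ) ≠ 0 := by positivity
    rw [div_mul_div_cancel₀ hm', ← add_div, Finset.sum_range_succ']
    congr 2
    · refine Finset.sum_congr rfl fun j _ => ?_
      rw [heldTimestamp, timestamp_succ]
      ring
    · rw [heldTimestamp, timestamp_zero]
      ring
  refine ((h2.div_const 2).add hwait).congr fun m => ?_
  rw [(age_integral_timestamp hi hx hu m).2, Finset.sum_add_distrib, add_div, ← Finset.sum_div]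
  ring

/-! ### Moments of the shifted exponential law -/

lemma memLp_two_id_expMeasure {lam : ℝ} (hlam : 0 < lam) : MemLp id 2 (expMeasure lam) := by
  rw [memLp_two_iff_integrable_sq aestronglyMeasurable_id, expMeasure, gammaMeasure,
    integrable_withDensity_iff_integrable_smul'
      (f := gammaPDF 1 lam) (measurable_gammaPDFReal 1 lam).ennreal_ofReal (ae_of_all _ fun _ => ENNReal.ofReal_lt_top)]
  have hpdf : ∀ x : ℝ, (gammaPDF 1 lam x).toReal • id x ^ 2 =
      (Set.Ici (0 : ℝ)).indicator (fun x => lam * (x ^ (2 : ℝ) * Real.exp (-lam * x ^ (1 : ℝ)))) x := by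
    intro x
    rw [gammaPDF, ENNReal.toReal_ofReal (gammaPDFReal_nonneg one_pos hlam x), gammaPDFReal]
    by_cases hx : 0 ≤ x
    · simp [hx]
      ring
    · simp [hx]
  simp_rw [hpdf]
  rw [integrable_indicator_iff measurableSet_Ici, integrableOn_Ici_iff_integrableOn_Ioi]
  exact (integrableOn_rpow_mul_exp_neg_mul_rpow (by norm_num) one_pos hlam).const_mul lam

variable {lam c : ℝ}

lemma isProbabilityMeasure_shiftedExp (hlam : 0 < lam) :
    IsProbabilityMeasure (shiftedExp lam c) :=
  have := isProbabilityMeasure_expMeasure hlam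
  Measure.isProbabilityMeasure_map (by fun_prop)

lemma memLp_two_id_shiftedExp (hlam : 0 < lam) : MemLp id 2 (shiftedExp lam c) := by
  have := isProbabilityMeasure_expMeasure hlam
  rw [shiftedExp, memLp_map_measure_iff aestronglyMeasurable_id (by fun_prop)]
  exact (memLp_const c).add (memLp_two_id_expMeasure hlam)

lemma shiftedExp_real_Iic (hlam : 0 < lam) {t : ℝ} (ht : 0 ≤ t) :
    (shiftedExp lam c).real (Set.Iic (c + t)) = 1 - Real.exp (-(lam * t)) := by
  have := isProbabilityMeasure_expMeasure hlam
  have hpre : (fun z => c + z) ⁻¹' Set.Iic (c + t) = Set.Iic t := by ext z; simp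
  rw [shiftedExp, map_measureReal_apply (by fun_prop) measurableSet_Iic, hpre, ← cdf_eq_real,
    cdf_expMeasure_eq hlam, if_pos ht]

/-- The strict inequality keeps delays positive even when `c = 0`. -/
lemma ae_lt_shiftedExp (hlam : 0 < lam) : ∀ᵐ x ∂(shiftedExp lam c), c < x := by
  have := isProbabilityMeasure_shiftedExp (c := c) hlam
  have h := shiftedExp_real_Iic (c := c) hlam le_rfl
  rw [add_zero, mul_zero, neg_zero, Real.exp_zero, sub_self, measureReal_eq_zero_iff] at h
  rw [ae_iff]
  simpa [Set.Iic] using h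

/-- A primitive is `(1 - exp (-lam t)) ^ (j + 1) / (lam (j + 1))`. These integrals are the terms of
the harmonic sum in the mean of the maximum. -/
lemma integral_exp_mul_one_sub_exp_pow (hlam : 0 < lam) (j : ℕ) :
    IntegrableOn (fun t => Real.exp (-(lam * t)) * (1 - Real.exp (-(lam * t))) ^ j) (Set.Ioi 0) ∧
    ∫ t in Set.Ioi (0 : ℝ), Real.exp (-(lam * t)) * (1 - Real.exp (-(lam * t))) ^ j
      = 1 / lam * (1 / (j + 1 : ℝ)) := by
  have hd : ∀ t ∈ Set.Ici (0 : ℝ),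
      HasDerivAt (fun t => (1 / lam * (1 / (j + 1 : ℝ))) * (1 - Real.exp (-(lam * t))) ^ (j + 1))
        (Real.exp (-(lam * t)) * (1 - Real.exp (-(lam * t))) ^ j) t := by
    intro t _
    have h1 : HasDerivAt (fun t => -lam * t) (-lam) t := by
      simpa using (hasDerivAt_id t).const_mul (-lam)
    simp_rw [← neg_mul]
    have h2 := (((h1.exp.const_sub 1).pow (j + 1)).const_mul (1 / lam * (1 / (j + 1 : ℝ))))
    convert! h2 using 1
    have : (j + 1 : ℝ) ≠ 0 := by positivity
    push_cast
    field_simp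
  have hpos : ∀ t ∈ Set.Ioi (0 : ℝ),
      0 ≤ Real.exp (-(lam * t)) * (1 - Real.exp (-(lam * t))) ^ j := by
    intro t ht
    have : Real.exp (-(lam * t)) ≤ 1 :=
      Real.exp_le_one_iff.2 (by have := mul_pos hlam ht; linarith)
    exact mul_nonneg (Real.exp_pos _).le (pow_nonneg (by linarith) _)
  have hlim : Tendsto
      (fun t => (1 / lam * (1 / (j + 1 : ℝ))) * (1 - Real.exp (-(lam * t))) ^ (j + 1)) atTop
      (𝓝 (1 / lam * (1 / (j + 1 : ℝ)))) := by
    have h0 : Tendsto (fun t => Real.exp (-(lam * t))) atTop (𝓝 0) :=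
      Real.tendsto_exp_neg_atTop_nhds_zero.comp (tendsto_id.const_mul_atTop hlam)
    simpa using ((h0.const_sub 1).pow (j + 1)).const_mul (1 / lam * (1 / (j + 1 : ℝ)))
  refine ⟨integrableOn_Ioi_deriv_of_nonneg' hd hpos hlim, ?_⟩
  rw [integral_Ioi_of_hasDerivAt_of_nonneg' hd hpos hlim]
  simp

/-- The mean of a variable distributed as the maximum of `k` independent shifted exponentials. -/
lemma integral_of_real_le_eq_pow {α : Type*} [MeasurableSpace α] {Q : Measure α}
    [IsProbabilityMeasure Q] (hlam : 0 < lam) {f : α → ℝ} (hfm : Measurable f)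
    (hf : Integrable f Q) (k : ℕ) (hk : 1 ≤ k)
    (hQ : ∀ t, 0 ≤ t → Q.real {a | f a ≤ c + t} = (1 - Real.exp (-(lam * t))) ^ k) :
    ∫ a, f a ∂Q = c + 1 / lam * (harmonic k : ℝ) := by
  have hg : Integrable (fun a => f a - c) Q := hf.sub (integrable_const c)
  have hnn : 0 ≤ᵐ[Q] fun a => f a - c := by
    -- At `t = 0` the hypothesis says that `f > c` almost surely, since `k ≥ 1`.
    have h0 := hQ 0 le_rfl
    rw [mul_zero, neg_zero, Real.exp_zero, sub_self, zero_pow (by omega), add_zero,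
      measureReal_eq_zero_iff] at h0
    have : ∀ᵐ a ∂Q, ¬ f a ≤ c := by
      rw [ae_iff]; simpa using h0
    filter_upwards [this] with a ha
    simp only [Pi.zero_apply, sub_nonneg]
    linarith
  have hlc := hg.integral_eq_integral_meas_lt hnn
  rw [integral_sub hf (integrable_const c)] at hlc
  simp only [integral_const, probReal_univ, one_smul] at hlc
  -- The tail is a geometric sum: with `q = exp (-lam t)`, `1 - (1 - q) ^ k = q * ∑ j < k, (1 - q) ^
  -- j`.
  have hcong : ∫ t in Set.Ioi (0 : ℝ), Q.real {a | t < f a - c} =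
      ∫ t in Set.Ioi (0 : ℝ), ∑ j ∈ Finset.range k,
        Real.exp (-(lam * t)) * (1 - Real.exp (-(lam * t))) ^ j := by
    refine setIntegral_congr_fun measurableSet_Ioi fun t ht => ?_
    have hset : {a | t < f a - c} = {a | f a ≤ c + t}ᶜ := by
      ext a; simp [lt_sub_iff_add_lt, add_comm]
    rw [hset, probReal_compl_eq_one_sub (measurableSet_le hfm measurable_const),
      hQ t (le_of_lt ht), ← Finset.mul_sum]
    have := mul_neg_geom_sum (1 - Real.exp (-(lam * t))) k
    rw [sub_sub_cancel] at this
    exact this.symm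
  rw [hcong, integral_finsetSum _ fun j _ => (integral_exp_mul_one_sub_exp_pow hlam j).1] at hlc
  simp_rw [(integral_exp_mul_one_sub_exp_pow hlam _).2, ← Finset.mul_sum] at hlc
  rw [harmonic]
  push_cast
  simp_rw [one_div] at hlc ⊢
  linarith

lemma integral_id_shiftedExp (hlam : 0 < lam) : ∫ x, x ∂(shiftedExp lam c) = c + 1 / lam := by
  have := isProbabilityMeasure_shiftedExp (c := c) hlam
  have := integral_of_real_le_eq_pow (c := c) (f := id) hlam measurable_id
    ((memLp_two_id_shiftedExp hlam).integrable one_le_two) 1 le_rfl fun t ht => by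
      rw [pow_one, ← shiftedExp_real_Iic hlam ht]; rfl
  simpa using this

/-! ### The maximum of `k` delays -/

/-- The law of the maximum of `k` independent shifted exponential variables. -/
noncomputable def maxLaw (lam c : ℝ) (k : ℕ) : Measure ℝ :=
  (Measure.pi fun _ : Fin k => shiftedExp lam c).map fun v => ⨆ i, v i

lemma measurable_iSup_apply {ι : Type*} [Countable ι] : Measurable fun v : ι → ℝ => ⨆ i, v i :=
  Measurable.iSup fun i => measurable_pi_apply i

lemma isProbabilityMeasure_maxLaw (hlam : 0 < lam) (k : ℕ) :
    IsProbabilityMeasure (maxLaw lam c k) :=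
  have := isProbabilityMeasure_shiftedExp (c := c) hlam
  Measure.isProbabilityMeasure_map measurable_iSup_apply.aemeasurable

lemma memLp_two_id_maxLaw (hlam : 0 < lam) {k : ℕ} (hk : 1 ≤ k) :
    MemLp id 2 (maxLaw lam c k) := by
  have := isProbabilityMeasure_shiftedExp (c := c) hlam
  have : Nonempty (Fin k) := ⟨⟨0, hk⟩⟩
  rw [maxLaw, memLp_map_measure_iff aestronglyMeasurable_id measurable_iSup_apply.aemeasurable]
  have hi : ∀ i : Fin k, MemLp (fun v : Fin k → ℝ => ‖v i‖) 2
      (Measure.pi fun _ : Fin k => shiftedExp lam c) := fun i =>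
    ((memLp_two_id_shiftedExp hlam).comp_measurePreserving
      (measurePreserving_eval (fun _ : Fin k => shiftedExp lam c) i)).norm
  -- The maximum is one of the coordinates, so it is dominated by the sum of their absolute values.
  refine (memLp_finsetSum Finset.univ fun i _ => hi i).mono
    measurable_iSup_apply.aestronglyMeasurable (ae_of_all _ fun v => ?_)
  obtain ⟨i, hi⟩ := exists_eq_ciSup_of_finite (f := v)
  simp only [Function.comp_apply, id_eq]
  rw [← hi, Real.norm_of_nonneg (Finset.sum_nonneg fun i _ => norm_nonneg (v i))]
  exact Finset.single_le_sum (f := fun i => ‖v i‖) (fun i _ => norm_nonneg _) (Finset.mem_univ i)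

lemma integral_id_maxLaw (hlam : 0 < lam) {k : ℕ} (hk : 1 ≤ k) :
    ∫ y, y ∂(maxLaw lam c k) = c + 1 / lam * (harmonic k : ℝ) := by
  have := isProbabilityMeasure_shiftedExp (c := c) hlam
  have := isProbabilityMeasure_maxLaw (c := c) hlam k
  have : Nonempty (Fin k) := ⟨⟨0, hk⟩⟩
  refine integral_of_real_le_eq_pow (f := id) hlam measurable_id
    ((memLp_two_id_maxLaw hlam hk).integrable one_le_two) k hk fun t ht => ?_
  have hpre : (fun v : Fin k → ℝ => ⨆ i, v i) ⁻¹' {a | id a ≤ c + t} =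
      Set.univ.pi fun _ => Set.Iic (c + t) := by
    ext v
    simp [ciSup_le_iff (Set.finite_range v).bddAbove, Pi.le_def]
  rw [maxLaw, map_measureReal_apply measurable_iSup_apply
    (measurableSet_le measurable_id measurable_const), hpre,
    measureReal_def, Measure.pi_pi, ENNReal.toReal_prod]
  simp [← shiftedExp_real_Iic (c := c) hlam ht, measureReal_def]

lemma sq_integral_id_maxLaw_le (hlam : 0 < lam) {k : ℕ} (hk : 1 ≤ k) :
    (∫ y, y ∂(maxLaw lam c k)) ^ 2 ≤ ∫ y, y ^ 2 ∂(maxLaw lam c k) := by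
  have := isProbabilityMeasure_maxLaw (c := c) hlam k
  have h := variance_eq_sub (memLp_two_id_maxLaw (c := c) hlam hk)
  have h0 := variance_nonneg (id : ℝ → ℝ) (maxLaw lam c k)
  simp only [Pi.pow_apply, id_eq] at h
  linarith

/-! ### Independence across updates -/

/-- Functionals of disjoint finite parts of an independent family are independent. -/
lemma indepFun_of_dependsOn {ι Ω : Type*} [MeasurableSpace Ω] {P : Measure Ω} {X : ι → Ω → ℝ}
    (h : iIndepFun X P) (hm : ∀ p, AEMeasurable (X p) P) {S T : Finset ι} (hST : Disjoint S T)
    {F G : (ι → ℝ) → ℝ} (hF : Measurable F) (hG : Measurable G)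
    (hFS : DependsOn F S) (hGT : DependsOn G T) :
    IndepFun (fun ω => F fun p => X p ω) (fun ω => G fun p => X p ω) P := by
  classical
  -- Extension by zero turns `F` and `G` into functions of finitely many coordinates; `DependsOn`
  -- makes the filled-in values harmless.
  let ext : (U : Finset ι) → (U → ℝ) → ι → ℝ := fun U v p => if hp : p ∈ U then v ⟨p, hp⟩ else 0
  have hext : ∀ U, Measurable (ext U) := fun U => measurable_pi_lambda _ fun p => by
    by_cases hp : p ∈ U
    · simpa [ext, hp] using measurable_pi_apply _
    · simp [ext, hp]
  have key := (h.indepFun_finset₀ S T hST hm).comp (hF.comp (hext S)) (hG.comp (hext T))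
  convert! key using 1
  · funext ω
    refine hFS fun p hp => ?_
    simp [ext, Finset.mem_coe.1 hp]
  · funext ω
    refine hGT fun p hp => ?_
    simp [ext, Finset.mem_coe.1 hp]

lemma measurable_serviceInterval {n k : ℕ} (j : ℕ) :
    Measurable fun v : Fin n × ℕ → ℝ => serviceInterval k (fun i j => v (i, j)) j :=
  Measurable.iSup fun _ => measurable_pi_apply _

lemma dependsOn_serviceInterval {n k : ℕ} {j : ℕ} {J : Finset ℕ} (hj : j ∈ J) :
    DependsOn (fun v : Fin n × ℕ → ℝ => serviceInterval k (fun i j => v (i, j)) j)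
      (((Finset.univ : Finset (Fin n)) ×ˢ J : Finset (Fin n × ℕ)) : Set (Fin n × ℕ)) := by
  intro v w h
  exact iSup_congr fun i => h (i.1, j) (by simpa using hj)

/-- Indexing by `Fin k` removes `n` from the law of the service interval. -/
lemma serviceInterval_eq_iSup_castLE {n k : ℕ} (hkn : k ≤ n) (x : Fin n → ℕ → ℝ) (j : ℕ) :
    serviceInterval k x j = ⨆ a : Fin k, x (Fin.castLE hkn a) j := by
  let e : Fin k ≃ {i : Fin n // (i : ℕ) < k} :=
    { toFun := fun a => ⟨Fin.castLE hkn a, a.2⟩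
      invFun := fun i => ⟨i.1, i.2⟩
      left_inv := fun _ => rfl
      right_inv := fun _ => rfl }
  exact (e.iSup_comp (g := fun i => x i.1 j)).symm

/-! ### Strong laws for service intervals and waiting terms -/

section Random

variable {lam c : ℝ} {n k : ℕ} {Ω : Type*} [MeasurableSpace Ω] {P : Measure Ω}
  {X : Fin n → ℕ → Ω → ℝ}

lemma hasLaw_serviceInterval (hkn : k ≤ n)
    (hind : iIndepFun (fun (p : Fin n × ℕ) => X p.1 p.2) P)
    (hlaw : ∀ i j, HasLaw (X i j) (shiftedExp lam c) P) (j : ℕ) :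
    HasLaw (fun ω => serviceInterval k (fun i j => X i j ω) j) (maxLaw lam c k) P := by
  simp_rw [serviceInterval_eq_iSup_castLE hkn]
  have hinj : Function.Injective fun a : Fin k => (Fin.castLE hkn a, j) := fun a b h =>
    Fin.castLE_injective hkn (Prod.ext_iff.1 h).1
  have h := (hind.precomp hinj).hasLaw_pi fun a => hlaw (Fin.castLE hkn a) j
  have hsup : HasLaw (fun v : Fin k → ℝ => ⨆ a, v a) (maxLaw lam c k)
      (Measure.pi fun _ : Fin k => shiftedExp lam c) :=
    ⟨measurable_iSup_apply.aemeasurable, rfl⟩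
  exact hsup.fun_comp h

lemma ae_pos_delay (hlam : 0 < lam) (hc : 0 ≤ c)
    (hlaw : ∀ i j, HasLaw (X i j) (shiftedExp lam c) P) (i : Fin n) :
    ∀ᵐ ω ∂P, ∀ j, 0 < X i j ω :=
  ae_all_iff.2 fun j => by
    have := ((hlaw i j).ae_iff (p := fun x => c < x) (by fun_prop)).2 (ae_lt_shiftedExp hlam)
    filter_upwards [this] with ω hω
    exact hc.trans_lt hω

lemma disjoint_univ_product {n : ℕ} {J L : Finset ℕ} (h : Disjoint J L) :
    Disjoint ((Finset.univ : Finset (Fin n)) ×ˢ J) ((Finset.univ : Finset (Fin n)) ×ˢ L) :=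
  Finset.disjoint_product.2 (Or.inr h)

lemma pairwise_indepFun_serviceInterval
    (hind : iIndepFun (fun (p : Fin n × ℕ) => X p.1 p.2) P)
    (hm : ∀ p : Fin n × ℕ, AEMeasurable (X p.1 p.2) P) :
    Pairwise fun j l => IndepFun (fun ω => serviceInterval k (fun i j => X i j ω) j)
      (fun ω => serviceInterval k (fun i j => X i j ω) l) P := by
  intro j l hjl
  exact indepFun_of_dependsOn hind hm
    (disjoint_univ_product (Finset.disjoint_singleton.2 hjl))
    (measurable_serviceInterval j) (measurable_serviceInterval l)
    (dependsOn_serviceInterval (Finset.mem_singleton_self j))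
    (dependsOn_serviceInterval (Finset.mem_singleton_self l))

lemma indepFun_delay_serviceInterval
    (hind : iIndepFun (fun (p : Fin n × ℕ) => X p.1 p.2) P)
    (hm : ∀ p : Fin n × ℕ, AEMeasurable (X p.1 p.2) P) (i : Fin n) (j : ℕ) :
    IndepFun (X i (j + 1)) (fun ω => serviceInterval k (fun i j => X i j ω) j) P :=
  indepFun_of_dependsOn (F := fun v => v (i, j + 1)) hind hm
    (disjoint_univ_product (J := {j + 1}) (L := {j}) (by simp))
    (measurable_pi_apply _) (measurable_serviceInterval j)
    (fun v w h => h (i, j + 1) (by simp))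
    (dependsOn_serviceInterval (Finset.mem_singleton_self j))

lemma indepFun_delay_mul_serviceInterval
    (hind : iIndepFun (fun (p : Fin n × ℕ) => X p.1 p.2) P)
    (hm : ∀ p : Fin n × ℕ, AEMeasurable (X p.1 p.2) P) (i : Fin n) {j l : ℕ}
    (hjl : Disjoint ({j, j + 1} : Finset ℕ) {l, l + 1}) :
    IndepFun (fun ω => X i (j + 1) ω * serviceInterval k (fun i j => X i j ω) j)
      (fun ω => X i (l + 1) ω * serviceInterval k (fun i j => X i j ω) l) P := by
  have hmeas : ∀ j, Measurable fun v : Fin n × ℕ → ℝ =>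
      v (i, j + 1) * serviceInterval k (fun i j => v (i, j)) j := fun j =>
    (measurable_pi_apply _).mul (measurable_serviceInterval j)
  have hdep : ∀ j : ℕ, DependsOn (fun v : Fin n × ℕ → ℝ =>
      v (i, j + 1) * serviceInterval k (fun i j => v (i, j)) j)
      (((Finset.univ : Finset (Fin n)) ×ˢ ({j, j + 1} : Finset ℕ) : Finset (Fin n × ℕ)) :
        Set (Fin n × ℕ)) := fun j v w h => by
    have h2 := dependsOn_serviceInterval (k := k) (show j ∈ ({j, j + 1} : Finset ℕ) by simp) h
    simp only at h2
    simp only [h2, h (i, j + 1) (by simp)]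
  exact indepFun_of_dependsOn hind hm (disjoint_univ_product hjl) (hmeas j) (hmeas l)
    (hdep j) (hdep l)

lemma ae_tendsto_average_serviceInterval (hkn : k ≤ n)
    (hind : iIndepFun (fun (p : Fin n × ℕ) => X p.1 p.2) P)
    (hlaw : ∀ i j, HasLaw (X i j) (shiftedExp lam c) P) {φ : ℝ → ℝ} (hφ : Measurable φ)
    (hint : Integrable φ (maxLaw lam c k)) :
    ∀ᵐ ω ∂P, Tendsto (fun m : ℕ =>
      (∑ j ∈ Finset.range m, φ (serviceInterval k (fun i j => X i j ω) j)) / m) atTop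
      (𝓝 (∫ y, φ y ∂(maxLaw lam c k))) := by
  have hY := hasLaw_serviceInterval hkn hind hlaw
  have hφY : ∀ j, HasLaw (fun ω => φ (serviceInterval k (fun i j => X i j ω) j))
      ((maxLaw lam c k).map φ) P := fun j =>
    HasLaw.fun_comp ⟨hφ.aemeasurable, rfl⟩ (hY j)
  have h := strong_law_ae_real (μ := P)
    (fun j ω => φ (serviceInterval k (fun i j => X i j ω) j)) ?_ ?_ fun j =>
      (hφY j).identDistrib (hφY 0)
  · have e := (hY 0).integral_comp hint.aestronglyMeasurable
    simp only [Function.comp_def] at e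
    rwa [e] at h
  · rw [← (hY 0).map_eq] at hint
    exact hint.comp_aemeasurable (hY 0).aemeasurable
  · intro j l hjl
    exact (pairwise_indepFun_serviceInterval hind (fun p => (hlaw p.1 p.2).aemeasurable) hjl).comp
      hφ hφ

/-- Consecutive products share an update, so they need not be independent. Those of even index use
disjoint pairs of updates, as do those of odd index; the strong law applies to each class and the
two averages are merged. -/
lemma ae_tendsto_average_delay_mul_serviceInterval (hlam : 0 < lam) (hk : 1 ≤ k) (hkn : k ≤ n)
    (hind : iIndepFun (fun (p : Fin n × ℕ) => X p.1 p.2) P)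
    (hlaw : ∀ i j, HasLaw (X i j) (shiftedExp lam c) P) (i : Fin n) :
    ∀ᵐ ω ∂P, Tendsto (fun m : ℕ => (∑ j ∈ Finset.range m,
      X i (j + 1) ω * serviceInterval k (fun i j => X i j ω) j) / m) atTop
      (𝓝 ((c + 1 / lam) * ∫ y, y ∂(maxLaw lam c k))) := by
  have := isProbabilityMeasure_shiftedExp (c := c) hlam
  have := isProbabilityMeasure_maxLaw (c := c) hlam k
  have hm := fun p : Fin n × ℕ => (hlaw p.1 p.2).aemeasurable
  have hY := hasLaw_serviceInterval hkn hind hlaw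
  have hXY := fun j => indepFun_delay_serviceInterval (k := k) hind hm i j
  have hlawW := fun j => (hXY j).hasLaw_fun_mul (hlaw i (j + 1)) (hY j)
  have hX1 : ∀ j, Integrable (X i j) P := fun j => by
    have h := (memLp_two_id_shiftedExp (c := c) hlam).integrable one_le_two
    rw [← (hlaw i j).map_eq] at h
    exact h.comp_aemeasurable (hlaw i j).aemeasurable
  have hY1 : ∀ j, Integrable (fun ω => serviceInterval k (fun i j => X i j ω) j) P := fun j => by
    have h := (memLp_two_id_maxLaw (c := c) hlam hk).integrable one_le_two
    rw [← (hY j).map_eq] at h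
    exact h.comp_aemeasurable (hY j).aemeasurable
  have hsub : ∀ b : ℕ, ∀ᵐ ω ∂P, Tendsto (fun m : ℕ => (∑ j ∈ Finset.range m,
      X i (2 * j + b + 1) ω * serviceInterval k (fun i j => X i j ω) (2 * j + b)) / m) atTop
      (𝓝 ((c + 1 / lam) * ∫ y, y ∂(maxLaw lam c k))) := by
    intro b
    have h := strong_law_ae_real (μ := P)
      (fun j ω => X i (2 * j + b + 1) ω * serviceInterval k (fun i j => X i j ω) (2 * j + b))
      ((hXY _).integrable_mul (hX1 _) (hY1 _)) ?_ fun j =>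
        (hlawW _).identDistrib (hlawW _)
    · rwa [(hXY _).integral_fun_mul_eq_mul_integral (hX1 _).aestronglyMeasurable
        (hY1 _).aestronglyMeasurable, (hlaw _ _).integral_eq, (hY _).integral_eq,
        integral_id_shiftedExp hlam] at h
    · intro j l hjl
      refine indepFun_delay_mul_serviceInterval hind hm i ?_
      rw [Finset.disjoint_left]
      intro a ha hb
      simp only [Finset.mem_insert, Finset.mem_singleton] at ha hb
      omega
  filter_upwards [hsub 0, hsub 1] with ω h0 h1
  exact tendsto_average_of_even_of_odd h0 h1

end Random

/-! ### The value of the limit and its lower bound -/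

/-- The time-average age of a priority node. -/
noncomputable def averageAge (lam c : ℝ) (k : ℕ) : ℝ :=
  ((∫ y, y ^ 2 ∂(maxLaw lam c k)) / 2 + (c + 1 / lam) * ∫ y, y ∂(maxLaw lam c k)) /
    ∫ y, y ∂(maxLaw lam c k)

lemma integral_id_maxLaw_pos {lam c : ℝ} (hlam : 0 < lam) (hc : 0 ≤ c) {k : ℕ} (hk : 1 ≤ k) :
    0 < ∫ y, y ∂(maxLaw lam c k) := by
  rw [integral_id_maxLaw hlam hk]
  have : 0 < (harmonic k : ℝ) := by exact_mod_cast harmonic_pos (by omega)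
  positivity

lemma le_averageAge {lam c : ℝ} (hlam : 0 < lam) (hc : 0 ≤ c) {k : ℕ} (hk : 1 ≤ k) :
    3 * c / 2 + 1 / lam + (Real.log k + Real.eulerMascheroniConstant) / (2 * lam) ≤
      averageAge lam c k := by
  have hpos := integral_id_maxLaw_pos hlam hc hk
  have hsq := sq_integral_id_maxLaw_le (c := c) hlam hk
  have hmean := integral_id_maxLaw (c := c) hlam hk
  -- `H_k - log k` stays above its limit `γ`.
  have hH : Real.log k + Real.eulerMascheroniConstant ≤ harmonic k := by
    have := Real.eulerMascheroniConstant_lt_eulerMascheroniSeq' k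
    rw [Real.eulerMascheroniSeq', if_neg (by omega)] at this
    linarith
  rw [averageAge]
  set M := ∫ y, y ∂(maxLaw lam c k)
  have h1 : (Real.log k + Real.eulerMascheroniConstant) / (2 * lam) ≤ 1 / lam * harmonic k / 2 := by
    calc _ ≤ (harmonic k : ℝ) / (2 * lam) := by gcongr
      _ = _ := by field_simp
  -- After multiplication by `M > 0` this is `M ^ 2 ≤ E[Y²]`, the nonnegativity of the variance.
  have h2 : M / 2 + (c + 1 / lam) ≤
      ((∫ y, y ^ 2 ∂(maxLaw lam c k)) / 2 + (c + 1 / lam) * M) / M := by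
    rw [le_div_iff₀ hpos]
    linarith
  linarith

end MulticastAge

theorem corollary1 (lam c : ℝ) (hlam : 0 < lam) (hc : 0 ≤ c) (k : ℕ) (hk : 1 ≤ k) :
    ∃ ΔP : ℝ,
      (∀ (n : ℕ), k ≤ n →
        ∀ (Ω : Type*) [MeasurableSpace Ω] (P : Measure Ω) [IsProbabilityMeasure P]
          (X : Fin n → ℕ → Ω → ℝ) (u₀ : Fin n → Ω → ℝ),
          iIndepFun (fun (p : Fin n × ℕ) => X p.1 p.2) P →
          (∀ i j, HasLaw (X i j) (MulticastAge.shiftedExp lam c) P) →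
          (∀ i ω, u₀ i ω ≤ 0) →
          ∀ i : Fin n, (i : ℕ) < k →
            ∀ᵐ ω ∂P, MulticastAge.HasTimeAverage
              (MulticastAge.age k (fun i' j => X i' j ω) (u₀ i ω) i) ΔP) ∧
      3 * c / 2 + 1 / lam + (Real.log k + Real.eulerMascheroniConstant) / (2 * lam) ≤ ΔP := by
  refine ⟨MulticastAge.averageAge lam c k, ?_, MulticastAge.le_averageAge hlam hc hk⟩
  intro n hkn Ω _ P _ X u₀ hind hlaw hu i hi
  have hL2 := MulticastAge.memLp_two_id_maxLaw (c := c) hlam hk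
  have := MulticastAge.isProbabilityMeasure_maxLaw (c := c) hlam k
  filter_upwards [MulticastAge.ae_pos_delay hlam hc hlaw i,
    MulticastAge.ae_tendsto_average_serviceInterval hkn hind hlaw
      measurable_id (hL2.integrable one_le_two),
    MulticastAge.ae_tendsto_average_serviceInterval hkn hind hlaw
      (φ := fun y => y ^ 2) (by fun_prop) hL2.integrable_sq,
    MulticastAge.ae_tendsto_average_delay_mul_serviceInterval hlam hk hkn hind hlaw i]
    with ω hpos h1 h2 hW
  exact MulticastAge.hasTimeAverage_age hi hpos (hu i ω)
    (MulticastAge.integral_id_maxLaw_pos hlam hc hk) h1 h2 hW
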